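/- Work over $\mathbb{C}$, let $n\ge 0$ be an integer, and let $C,D\subset\mathbb{P}^n$ be non-degenerate rational curves of degree $n+1$, with birational parameterizations $\mathbf p,\mathbf q:\mathbb{P}^1\to\mathbb{P}^n$, $\mathbf p(\mathbb{P}^1)=C$, $\mathbf q(\mathbb{P}^1)=D$. That is, $\mathbf p=[p_0:\dots:p_n]$, where $p_0,\dots,p_n\in\mathbb{C}[s,t]$ are homogeneous of degree $n+1$, have no common factor and are linearly independent over $\mathbb{C}$, and $\mathbf p$ is injective outside a finite subset of $\mathbb{P}^1$; likewise for $\mathbf q$. The osculating polynomial of $\mathbf p$ is the binary form $$\Delta_{\mathbf p}(s,t)=\det\left[\frac{\partial^n \mathbf p}{\partial s^n},\frac{\partial^n \mathbf p}{\partial s^{n-1}\partial t},\dots,\frac{\partial^n \mathbf p}{\partial t^n}\right].$$ Let $\mathrm{Aut}(\mathbb{P}^m)=PGL_{m+1}(\mathbb{C})$ be the group of projective transformations of $\mathbb{P}^m$, put $\mathrm{Aut}(\mathbb{P}^n)_{C,D}=\{\varphi\in\mathrm{Aut}(\mathbb{P}^n):\varphi(C)=D\}$ and, for binary forms $F,G$,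 put $\mathrm{Aut}(\mathbb{P}^1)_{F,G}=\{\psi\in\mathrm{Aut}(\mathbb{P}^1):\ G\circ\psi=\lambda F\text{ for some }\lambda\in\mathbb{C}^*\}$. Then: 1. For every $\varphi\in\mathrm{Aut}(\mathbb{P}^n)_{C,D}$ there is exactly one $\psi\in\mathrm{Aut}(\mathbb{P}^1)$ with $\varphi\circ\mathbf p=\mathbf q\circ\psi$, namely $\iota(\varphi)=\mathbf q^{-1}\circ\varphi\circ\mathbf p$; it lies in $\mathrm{Aut}(\mathbb{P}^1)_{\Delta_{\mathbf p},\Delta_{\mathbf q}}$; and the map $$\iota:\mathrm{Aut}(\mathbb{P}^n)_{C,D}\to\mathrm{Aut}(\mathbb{P}^1)_{\Delta_{\mathbf p},\Delta_{\mathbf q}}$$ is a bijection. 2. Consequently, $C$ and $D$ are projectively equivalent (that is, $\mathrm{Aut}(\mathbb{P}^n)_{C,D}\neq\emptyset$) if and only if their osculating polynomials are equivalent (that is, $\mathrm{Aut}(\mathbb{P}^1)_{\Delta_{\mathbf p},\Delta_{\mathbf q}}\neq\emptyset$). -/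

import Mathlib

open MvPolynomial
open scoped LinearAlgebra.Projectivization MatrixGroups

noncomputable section

namespace OsculatingCurves

/-- Complex projective space `ℙⁿ`, the set of lines through the origin of `ℂⁿ⁺¹`. -/
abbrev ProjSpace (n : ℕ) : Type := ℙ ℂ (Fin (n + 1) → ℂ)

/-- The group `Aut(ℙⁿ)` of projective transformations; it acts on `ProjSpace n` by `•`. -/
abbrev ProjAut (n : ℕ) : Type := PGL(Fin (n + 1), ℂ)

/-- Polynomials in the homogeneous coordinates `s = X 0`, `t = X 1` of `ℙ¹`. -/
abbrev BinPoly : Type := MvPolynomial (Fin 2) ℂ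

/-- `Aut(ℙⁿ)_{A,B}`, the projective transformations carrying the set `A` onto the set `B`. -/
def projEquivs {n : ℕ} (A B : Set (ProjSpace n)) : Set (ProjAut n) :=
  {φ | (fun x => φ • x) '' A = B}

/-- The substitution `G ∘ A` of a linear transformation `A` in a binary form `G`. -/
def substForm (A : GL (Fin 2) ℂ) (G : BinPoly) : BinPoly :=
  aeval (fun i : Fin 2 => ∑ j : Fin 2, C (A i j) * (X j : BinPoly)) G

/-- `Aut(ℙ¹)_{F,G}`, the automorphisms `ψ` of `ℙ¹` with `G ∘ ψ = μ F` for some `μ ≠ 0`. For a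
homogeneous `G` the condition does not depend on the matrix `A` that represents `ψ`. -/
def formEquivs (F G : BinPoly) : Set (ProjAut 1) :=
  {ψ | ∃ A : GL (Fin 2) ℂ, Matrix.ProjGenLinGroup.mk A = ψ ∧
    ∃ μ : ℂ, μ ≠ 0 ∧ substForm A G = C μ * F}

lemma aeval_mul_of_homogeneous {R : Type*} [CommRing R] [Algebra ℂ R] {d : ℕ} {f : BinPoly}
    (hf : f.IsHomogeneous d) (c : R) (g : Fin 2 → R) :
    aeval (fun j => c * g j) f = c ^ d * aeval g f := by
  conv_lhs => rw [f.as_sum]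
  conv_rhs => rw [f.as_sum]
  simp only [map_sum, Finset.mul_sum]
  refine Finset.sum_congr rfl fun m hm => ?_
  have hdeg : d = ∑ i ∈ m.support, m i := hf.degree_eq_sum_deg_support hm
  simp only [aeval_monomial, Finsupp.prod, mul_pow, Finset.prod_mul_distrib,
    Finset.prod_pow_eq_pow_sum, ← hdeg]
  ring

/-- A binary form that vanishes at the point `[v 0 : v 1]` is divisible by the linear form
`(v 1) s - (v 0) t`. -/
lemma linear_dvd_of_eval_eq_zero {d : ℕ} {f : BinPoly} (hf : f.IsHomogeneous d)
    {v : Fin 2 → ℂ} (hv : v ≠ 0) (h0 : eval v f = 0) :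
    (C (v 1) * X 0 - C (v 0) * X 1 : BinPoly) ∣ f := by
  obtain ⟨i, hi⟩ : ∃ i, v i ≠ 0 := by
    by_contra hcon
    push Not at hcon
    exact hv (funext hcon)
  set L : BinPoly := C (v 1) * X 0 - C (v 0) * X 1 with hL
  let π := Ideal.Quotient.mk (Ideal.span {L})
  have hLpi : π L = 0 := Ideal.Quotient.eq_zero_iff_mem.2 (Ideal.mem_span_singleton_self L)
  have key : ∀ j, π (C (v i) * X j) = π (C (v j) * X i) := by
    have h10 : π (C (v 1) * X 0) = π (C (v 0) * X 1) := by
      rw [← sub_eq_zero, ← map_sub]; exact hLpi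
    intro j
    fin_cases i <;> fin_cases j
    · rfl
    · exact h10.symm
    · exact h10
    · rfl
  have e1 : aeval (fun j => C (v i) * X j : Fin 2 → BinPoly) f = C (v i) ^ d * f := by
    rw [aeval_mul_of_homogeneous hf]; simp
  have e2 : aeval (fun j => C (v j) * X i : Fin 2 → BinPoly) f = 0 := by
    have h1 : (fun j => C (v j) * X i : Fin 2 → BinPoly) = fun j => X i * C (v j) := by
      funext j; ring
    have h2 : aeval (fun j => C (v j) : Fin 2 → BinPoly) f = C (eval v f) := by
      have := MvPolynomial.aeval_algebraMap_apply BinPoly v f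
      simpa [MvPolynomial.algebraMap_eq, Function.comp_def, MvPolynomial.coe_aeval_eq_eval] using this
    rw [h1, aeval_mul_of_homogeneous hf, h2, h0]; simp
  have e3 : π (C (v i) ^ d * f) = 0 := by
    rw [← e1, ← map_zero π, ← e2]
    rw [aeval_def, aeval_def, hom_eval₂, hom_eval₂]
    congr 1
    funext j
    exact key j
  have e4 : L ∣ C (v i) ^ d * f :=
    Ideal.mem_span_singleton.1 (Ideal.Quotient.eq_zero_iff_mem.1 e3)
  have hu : IsUnit (C (v i) ^ d : BinPoly) := ((isUnit_iff_ne_zero.2 hi).map C).pow d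
  exact (hu.dvd_mul_left).1 e4

/-- A morphism `ℙ¹ → ℙⁿ` given by forms `p₀, …, pₙ` of degree `d` without a common factor. -/
structure ProjLineMorphism (n d : ℕ) where
  coord : Fin (n + 1) → BinPoly
  isHomogeneous : ∀ i, (coord i).IsHomogeneous d
  no_common_factor : ∀ f : BinPoly, (∀ i, f ∣ coord i) → IsUnit f

namespace ProjLineMorphism

variable {n d : ℕ}

/-- The vector `(p₀(v), …, pₙ(v))`. -/
def vec (p : ProjLineMorphism n d) (v : Fin 2 → ℂ) : Fin (n + 1) → ℂ :=
  fun i => eval v (p.coord i)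

lemma vec_smul (p : ProjLineMorphism n d) (c : ℂ) (v : Fin 2 → ℂ) :
    p.vec (c • v) = c ^ d • p.vec v := by
  funext i
  simp only [vec, Pi.smul_apply, smul_eq_mul]
  exact aeval_mul_of_homogeneous (p.isHomogeneous i) c v

lemma vec_ne_zero (p : ProjLineMorphism n d) {v : Fin 2 → ℂ} (hv : v ≠ 0) : p.vec v ≠ 0 := by
  intro h
  have hu := p.no_common_factor _ fun i =>
    linear_dvd_of_eval_eq_zero (p.isHomogeneous i) hv (congrFun h i)
  have := hu.map (eval v)
  simp [mul_comm] at this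

/-- The morphism `ℙ¹ → ℙⁿ` as a map of points, `[s : t] ↦ [p₀(s, t) : ⋯ : pₙ(s, t)]`. -/
def toMap (p : ProjLineMorphism n d) : ProjSpace 1 → ProjSpace n :=
  Projectivization.lift
    (fun v : {v : Fin 2 → ℂ // v ≠ 0} => Projectivization.mk ℂ (p.vec v) (p.vec_ne_zero v.2))
    (by
      rintro ⟨v, hv⟩ ⟨w, hw⟩ c (rfl : v = c • w)
      have hc : c ≠ 0 := by rintro rfl; simp at hv
      refine (Projectivization.mk_eq_mk_iff' ℂ _ _ _ _).2 ⟨c ^ d, ?_⟩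
      exact (p.vec_smul c w).symm)

@[simp]
lemma toMap_mk (p : ProjLineMorphism n d) (v : Fin 2 → ℂ) (hv : v ≠ 0) :
    p.toMap (Projectivization.mk ℂ v hv) = Projectivization.mk ℂ (p.vec v) (p.vec_ne_zero hv) :=
  rfl

/-- The osculating polynomial `Δ_p`, the determinant of the `n + 1` columns
`∂ⁿp/∂sⁿ⁻ᵏ∂tᵏ`, `k = 0, …, n`. -/
def osculating (p : ProjLineMorphism n d) : BinPoly :=
  Matrix.det (Matrix.of fun i k : Fin (n + 1) =>
    (pderiv (0 : Fin 2))^[n - (k : ℕ)] ((pderiv (1 : Fin 2))^[(k : ℕ)] (p.coord i)))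

end ProjLineMorphism

/-- A birational parameterization `p : ℙ¹ → C` of a non-degenerate rational curve `C ⊂ ℙⁿ` of
degree `d`: the map is injective outside a finite set of parameters, and the coordinate forms are
linearly independent, that is, the image lies in no hyperplane. -/
structure RationalCurve (n d : ℕ) extends ProjLineMorphism n d where
  birational : ∃ S : Set (ProjSpace 1), S.Finite ∧ Set.InjOn toProjLineMorphism.toMap Sᶜ
  nondegenerate : LinearIndependent ℂ coord

/-- The curve itself, as a subset of `ℙⁿ`. -/
def RationalCurve.points {n d : ℕ} (p : RationalCurve n d) : Set (ProjSpace n) :=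
  Set.range p.toMap

end OsculatingCurves

end

/-!
Let `φ` carry `C = p(ℙ¹)` onto `D = q(ℙ¹)`. Both `φ ∘ p` and `q` are generically injective with
image `D`, so for a generic parameter `x` the point `φ (p x)` has a single `q`-preimage. It is the
only common root of the forms cutting it out, hence a rational function of `x`, and comparing
degrees shows that this rational function is a Möbius map `ψ`. Thus `φ` always lifts to some `ψ`.

Conversely `ψ`, induced by a matrix `A`, is a lift of some `φ` exactly when every `qᵢ ∘ A` lies in
the span of the `pⱼ`. That span is a hyperplane in the `(n + 2)`-dimensional space of forms of
degree `n + 1`, the kernel of the functional `f ↦ det (p₀, …, pₙ, f)` on coefficient vectors. On the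
power `(v₁ s - v₀ t) ^ (n + 1)` the functional equals `Δ_p(v)` up to a nonzero constant, and such
powers span, so `Δ_p` determines the hyperplane. Hence `A` transports one hyperplane to the other
if and only if `Δ_q ∘ A` is a nonzero multiple of `Δ_p`.
-/

noncomputable section

namespace OsculatingCurves

section NoCommonFactor

variable {ι R : Type*} [CommRing R] [IsDomain R] [UniqueFactorizationMonoid R] {p r : ι → R}

lemma dvd_of_forall_dvd_mul (hp : ∀ f, (∀ i, f ∣ p i) → IsUnit f) {a b : R} (ha : a ≠ 0)
    (h : ∀ i, a ∣ b * p i) : a ∣ b := by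
  induction a using UniqueFactorizationMonoid.induction_on_prime generalizing b with
  | h₁ => exact absurd rfl ha
  | h₂ u hu => exact hu.dvd
  | h₃ a π ha0 hπ ih =>
    obtain ⟨i, hi⟩ : ∃ i, ¬ π ∣ p i := by
      by_contra! hcon
      exact hπ.not_isUnit (hp π hcon)
    obtain ⟨b, rfl⟩ : π ∣ b := (hπ.dvd_or_dvd (dvd_of_mul_right_dvd (h i))).resolve_right hi
    refine mul_dvd_mul_left π (ih ha0 fun j => ?_)
    exact (mul_dvd_mul_iff_left hπ.ne_zero).1 (mul_assoc π b (p j) ▸ h j)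

lemma exists_eq_mul_of_cross_mul_eq (hp : ∀ f, (∀ i, f ∣ p i) → IsUnit f)
    (h : ∀ i j, r i * p j = r j * p i) : ∃ c, ∀ i, r i = c * p i := by
  obtain ⟨j, hj⟩ : ∃ j, p j ≠ 0 := by
    by_contra! hcon
    exact not_isUnit_zero (hp 0 fun i => by rw [hcon i])
  obtain ⟨c, hc⟩ : p j ∣ r j :=
    dvd_of_forall_dvd_mul hp hj fun i => ⟨r i, by rw [← h i j, mul_comm]⟩
  refine ⟨c, fun i => mul_right_cancel₀ hj ?_⟩
  rw [h i j, hc]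
  ring

lemma exists_isUnit_eq_mul_of_cross_mul_eq (hp : ∀ f, (∀ i, f ∣ p i) → IsUnit f)
    (hr : ∀ f, (∀ i, f ∣ r i) → IsUnit f) (h : ∀ i j, r i * p j = r j * p i) :
    ∃ c, IsUnit c ∧ ∀ i, r i = c * p i := by
  obtain ⟨c, hc⟩ := exists_eq_mul_of_cross_mul_eq hp h
  exact ⟨c, hr c fun i => ⟨p i, hc i⟩, hc⟩

end NoCommonFactor

section Projectivization

variable {ι K : Type*} [Field K]

lemma projectivization_mk_eq_mk_iff_cross {v w : ι → K} (hv : v ≠ 0) (hw : w ≠ 0) :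
    Projectivization.mk K v hv = Projectivization.mk K w hw ↔ ∀ i j, v i * w j = v j * w i := by
  rw [Projectivization.mk_eq_mk_iff']
  constructor
  · rintro ⟨a, rfl⟩ i j
    simp only [Pi.smul_apply, smul_eq_mul]
    ring
  · intro h
    obtain ⟨j, hj : w j ≠ 0⟩ := Function.ne_iff.1 hw
    refine ⟨v j / w j, funext fun i => ?_⟩
    rw [Pi.smul_apply, smul_eq_mul, div_mul_eq_mul_div, ← h i j, mul_div_cancel_right₀ _ hj]

/-- The point `[y : 1]` of the projective line over `K`. -/
def affinePoint (y : K) : ℙ K (Fin 2 → K) :=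
  Projectivization.mk K ![y, 1] fun h => by simpa using congrFun h 1

lemma mk_eq_affinePoint_div {v : Fin 2 → K} (hv : v ≠ 0) (h1 : v 1 ≠ 0) :
    Projectivization.mk K v hv = affinePoint (v 0 / v 1) := by
  rw [affinePoint, projectivization_mk_eq_mk_iff_cross]
  simp [Fin.forall_fin_two, mul_div_cancel₀, h1]

lemma affinePoint_injective : Function.Injective (affinePoint (K := K)) := by
  intro y z h
  simpa using (projectivization_mk_eq_mk_iff_cross _ _).1 h 0 1

lemma finite_compl_range_affinePoint : (Set.range (affinePoint (K := K)))ᶜ.Finite := by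
  refine Set.Subsingleton.finite fun x hx y hy => ?_
  have hinfty : ∀ (v : Fin 2 → K) (hv : v ≠ 0),
      Projectivization.mk K v hv ∉ Set.range affinePoint → v 1 = 0 := fun v hv h =>
    not_not.1 fun h1 => h ⟨_, (mk_eq_affinePoint_div hv h1).symm⟩
  induction x using Projectivization.ind with
  | h v hv =>
    induction y using Projectivization.ind with
    | h w hw =>
      rw [projectivization_mk_eq_mk_iff_cross]
      simp [Fin.forall_fin_two, hinfty v hv hx, hinfty w hw hy, mul_comm]

end Projectivization

section GenericallyInjective

variable {α β γ : Type*} {f : α → β} {g : γ → β}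

/-- A map that is injective outside a finite set: this is how the birationality of a
parameterization onto its image is expressed on points. -/
def GenericallyInjective (f : α → β) : Prop :=
  ∃ S : Set α, S.Finite ∧ Set.InjOn f Sᶜ

lemma GenericallyInjective.finite_preimage (hf : GenericallyInjective f) {B : Set β}
    (hB : B.Finite) : (f ⁻¹' B).Finite := by
  obtain ⟨S, hS, hinj⟩ := hf
  have himage : f '' (f ⁻¹' B \ S) ⊆ B := Set.image_subset_iff.2 Set.sdiff_subset
  exact ((hB.subset himage).of_finite_image (hinj.mono fun _ h => h.2)).of_sdiff hS

lemma GenericallyInjective.comp_injective (hf : GenericallyInjective f) {e : γ → α}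
    (he : Function.Injective e) : GenericallyInjective (f ∘ e) := by
  obtain ⟨S, hS, hinj⟩ := hf
  exact ⟨e ⁻¹' S, hS.preimage he.injOn, hinj.comp he.injOn fun _ h => h⟩

lemma GenericallyInjective.eventually_existsUnique_eq (hf : GenericallyInjective f)
    (hg : GenericallyInjective g) (h : (Set.range f \ Set.range g).Finite) :
    ∀ᶠ x in Filter.cofinite, ∃! y, f x = g y := by
  obtain ⟨T, hT, hinj⟩ := hg
  filter_upwards [(hf.finite_preimage (h.union (hT.image g))).compl_mem_cofinite] with x hx
  have hgood : ∀ y, f x = g y → y ∉ T := fun y hy hyT => hx (Or.inr ⟨y, hyT, hy.symm⟩)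
  obtain ⟨y, hy⟩ : f x ∈ Set.range g := by
    by_contra hcon
    exact hx (Or.inl ⟨⟨x, rfl⟩, hcon⟩)
  exact ⟨y, hy.symm, fun z hz => hinj (hgood z hz) (hgood y hy.symm) (hz.symm.trans hy.symm)⟩

lemma GenericallyInjective.eventually_eq_of_comp_eq (hf : GenericallyInjective f) {e e' : γ → α}
    (he : Function.Injective e) (he' : Function.Injective e') (h : ∀ x, f (e x) = f (e' x)) :
    ∀ᶠ x in Filter.cofinite, e x = e' x := by
  obtain ⟨S, hS, hinj⟩ := hf
  filter_upwards [(hS.preimage he.injOn).compl_mem_cofinite,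
    (hS.preimage he'.injOn).compl_mem_cofinite] with x hx hx'
  exact hinj hx hx' (h x)

end GenericallyInjective

section Dehomogenize

variable {R : Type*} [CommRing R]

/-- The dehomogenization `f(s, t) ↦ f(X, 1)`, the restriction of a binary form to the affine line
of the points `[u : 1]`. -/
def dehomogenize : MvPolynomial (Fin 2) R →ₐ[R] Polynomial R :=
  aeval ![Polynomial.X, 1]

lemma eq_of_dehomogenize_eq {d : ℕ} {f g : MvPolynomial (Fin 2) R} (hf : f.IsHomogeneous d)
    (hg : g.IsHomogeneous d) (h : dehomogenize f = dehomogenize g) : f = g :=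
  (Polynomial.homogenize_eq_of_isHomogeneous hf rfl).symm.trans
    (Polynomial.homogenize_eq_of_isHomogeneous hg h.symm)

lemma eval_aeval_polynomial (a : Fin 2 → Polynomial R) (f : MvPolynomial (Fin 2) R) (u : R) :
    (aeval a f).eval u = eval (fun i => (a i).eval u) f := by
  have h : (Polynomial.aeval u).comp (aeval a) =
      (aeval (fun i => (a i).eval u) : MvPolynomial (Fin 2) R →ₐ[R] R) := by
    ext i
    simp only [AlgHom.comp_apply, aeval_X, Polynomial.coe_aeval_eq_eval]
  simpa only [AlgHom.comp_apply, Polynomial.coe_aeval_eq_eval, aeval_eq_eval] using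
    DFunLike.congr_fun h f

lemma eval_dehomogenize (f : MvPolynomial (Fin 2) R) (u : R) :
    (dehomogenize f).eval u = eval ![u, 1] f := by
  rw [dehomogenize, eval_aeval_polynomial]
  congr 2
  funext i
  fin_cases i <;> simp

end Dehomogenize

section Substitution

lemma eval_substForm (A : GL (Fin 2) ℂ) (G : BinPoly) (v : Fin 2 → ℂ) :
    eval v (substForm A G) = eval (A • v) G := by
  have h : (aeval v : BinPoly →ₐ[ℂ] ℂ).comp
      (aeval fun i : Fin 2 => ∑ j : Fin 2, C (A i j) * (X j : BinPoly)) = aeval (A • v) := by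
    ext i
    simp only [AlgHom.comp_apply, aeval_X, map_sum, map_mul, algHom_C]
    rfl
  exact DFunLike.congr_fun h G

lemma isHomogeneous_substForm (A : GL (Fin 2) ℂ) {G : BinPoly} {d : ℕ} (hG : G.IsHomogeneous d) :
    (substForm A G).IsHomogeneous d := by
  simpa only [substForm, one_mul] using
    hG.aeval (fun i : Fin 2 => ∑ j : Fin 2, C (A i j) * (X j : BinPoly)) fun i =>
      IsHomogeneous.sum _ _ _ fun j _ => isHomogeneous_C_mul_X (A i j) j

lemma substForm_substForm_inv (A : GL (Fin 2) ℂ) (G : BinPoly) :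
    substForm A (substForm A⁻¹ G) = G :=
  MvPolynomial.funext fun v => by rw [eval_substForm, eval_substForm, inv_smul_smul]

lemma substForm_inv_substForm (A : GL (Fin 2) ℂ) (G : BinPoly) :
    substForm A⁻¹ (substForm A G) = G := by
  simpa only [inv_inv] using substForm_substForm_inv A⁻¹ G

/-- The substitution `G ↦ G ∘ A` as an automorphism of the algebra of polynomials. -/
def substEquiv (A : GL (Fin 2) ℂ) : BinPoly ≃ₐ[ℂ] BinPoly where
  __ := (aeval fun i => ∑ j, C (A i j) * X j : BinPoly →ₐ[ℂ] BinPoly)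
  invFun := substForm A⁻¹
  left_inv := substForm_inv_substForm A
  right_inv := substForm_substForm_inv A

lemma substEquiv_apply (A : GL (Fin 2) ℂ) (G : BinPoly) : substEquiv A G = substForm A G := rfl

end Substitution

namespace ProjLineMorphism

variable {n d : ℕ}

/-- The composition of a morphism `ℙ¹ → ℙⁿ` with a linear change of coordinates of `ℙⁿ`. -/
def postcomp (p : ProjLineMorphism n d) (M : GL (Fin (n + 1)) ℂ) : ProjLineMorphism n d where
  coord i := ∑ j, C (M i j) * p.coord j
  isHomogeneous i := IsHomogeneous.sum _ _ _ fun j _ => (p.isHomogeneous j).C_mul (M i j)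
  no_common_factor f hf := p.no_common_factor f fun i => by
    let N : GL (Fin (n + 1)) BinPoly := Matrix.GeneralLinearGroup.map C M
    have hinv : p.coord i = ∑ j, N⁻¹ i j * ∑ k, C (M j k) * p.coord k :=
      (congrFun (inv_smul_smul N p.coord) i).symm
    exact hinv ▸ Finset.dvd_sum fun j _ => (hf j).mul_left _

lemma vec_postcomp (p : ProjLineMorphism n d) (M : GL (Fin (n + 1)) ℂ) (v : Fin 2 → ℂ) :
    (p.postcomp M).vec v = M • p.vec v := by
  funext i
  simp only [vec, postcomp, map_sum, map_mul, eval_C]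
  rfl

lemma toMap_postcomp (p : ProjLineMorphism n d) (M : GL (Fin (n + 1)) ℂ) (x : ProjSpace 1) :
    (p.postcomp M).toMap x = (Matrix.ProjGenLinGroup.mk M : ProjAut n) • p.toMap x := by
  induction x using Projectivization.ind with
  | h v hv => simp only [toMap_mk, vec_postcomp, Projectivization.PGL.mk_smul_mk]

/-- The composition of a linear change of coordinates of `ℙ¹` with a morphism `ℙ¹ → ℙⁿ`. -/
def precomp (q : ProjLineMorphism n d) (A : GL (Fin 2) ℂ) : ProjLineMorphism n d where
  coord i := substForm A (q.coord i)
  isHomogeneous i := isHomogeneous_substForm A (q.isHomogeneous i)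
  no_common_factor f hf := by
    rw [← isUnit_map_iff (substEquiv A).symm]
    exact q.no_common_factor _ fun i => by
      simpa only [← substEquiv_apply, AlgEquiv.symm_apply_apply] using
        map_dvd (substEquiv A).symm (hf i)

lemma toMap_precomp (q : ProjLineMorphism n d) (A : GL (Fin 2) ℂ) (x : ProjSpace 1) :
    (q.precomp A).toMap x = q.toMap ((Matrix.ProjGenLinGroup.mk A : ProjAut 1) • x) := by
  induction x using Projectivization.ind with
  | h v hv =>
    have hvec : (q.precomp A).vec v = q.vec (A • v) := funext fun i => eval_substForm A _ v
    simp only [toMap_mk, hvec, Projectivization.PGL.mk_smul_mk]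

/-- The identity of `ℙ¹`, with coordinate forms `s` and `t`. -/
def idLine : ProjLineMorphism 1 1 where
  coord := X
  isHomogeneous := isHomogeneous_X ℂ
  no_common_factor f hf := by
    rcases (X_prime (R := ℂ) (i := (0 : Fin 2))).irreducible.dvd_iff.1 (hf 0) with hunit | hassoc
    · exact hunit
    · simpa using X_dvd_X.1 (hassoc.dvd.trans (hf 1))

lemma toMap_idLine (x : ProjSpace 1) : idLine.toMap x = x := by
  induction x using Projectivization.ind with
  | h v hv =>
    have hvec : idLine.vec v = v := funext fun i => eval_X i
    simp only [toMap_mk, hvec]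

lemma toMap_affinePoint_eq_iff (p q : ProjLineMorphism n d) (u y : ℂ) :
    p.toMap (affinePoint u) = q.toMap (affinePoint y) ↔ ∀ i j,
      (dehomogenize (p.coord i)).eval u * (dehomogenize (q.coord j)).eval y =
        (dehomogenize (p.coord j)).eval u * (dehomogenize (q.coord i)).eval y := by
  simp only [eval_dehomogenize]
  exact projectivization_mk_eq_mk_iff_cross _ _

theorem exists_coord_eq_C_mul_of_eventually_toMap_eq {p q : ProjLineMorphism n d}
    (h : ∀ᶠ x in Filter.cofinite, p.toMap x = q.toMap x) :
    ∃ c : ℂ, c ≠ 0 ∧ ∀ i, p.coord i = C c * q.coord i := by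
  have hcross : ∀ i j, p.coord i * q.coord j = p.coord j * q.coord i := fun i j => by
    refine eq_of_dehomogenize_eq ((p.isHomogeneous i).mul (q.isHomogeneous j))
      ((p.isHomogeneous j).mul (q.isHomogeneous i)) (Polynomial.eq_of_infinite_eval_eq _ _ ?_)
    refine Filter.frequently_cofinite_iff_infinite.1 (Filter.Eventually.frequently ?_)
    filter_upwards [affinePoint_injective.tendsto_cofinite.eventually h] with u hu
    simpa only [map_mul, Polynomial.eval_mul] using (toMap_affinePoint_eq_iff p q u u).1 hu i j
  obtain ⟨f, hf, hpq⟩ :=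
    exists_isUnit_eq_mul_of_cross_mul_eq q.no_common_factor p.no_common_factor hcross
  obtain ⟨c, hc, rfl⟩ := MvPolynomial.isUnit_iff_eq_C_of_isReduced.1 hf
  exact ⟨c, hc.ne_zero, hpq⟩

lemma toMap_eq_iff (p q : ProjLineMorphism n d) :
    (∀ x, p.toMap x = q.toMap x) ↔ ∃ c : ℂ, c ≠ 0 ∧ ∀ i, p.coord i = C c * q.coord i := by
  refine ⟨fun h => exists_coord_eq_C_mul_of_eventually_toMap_eq (Filter.Eventually.of_forall h), ?_⟩
  rintro ⟨c, -, hpq⟩ x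
  induction x using Projectivization.ind with
  | h v hv =>
    rw [toMap_mk, toMap_mk, Projectivization.mk_eq_mk_iff']
    exact ⟨c, funext fun i => by simp [vec, hpq]⟩

lemma smul_toMap_eq_toMap_smul_iff (p q : ProjLineMorphism n d) (M : GL (Fin (n + 1)) ℂ)
    (A : GL (Fin 2) ℂ) :
    (∀ x, (Matrix.ProjGenLinGroup.mk M : ProjAut n) • p.toMap x =
        q.toMap ((Matrix.ProjGenLinGroup.mk A : ProjAut 1) • x)) ↔
      ∃ c : ℂ, c ≠ 0 ∧ ∀ i, ∑ j, C (M i j) * p.coord j = C c * substForm A (q.coord i) := by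
  simp only [← toMap_postcomp, ← toMap_precomp]
  exact toMap_eq_iff _ _

lemma projAut_eq_of_eventually_smul_toMap_eq {p : ProjLineMorphism n d}
    (hp : LinearIndependent ℂ p.coord) {φ φ' : ProjAut n}
    (h : ∀ᶠ x in Filter.cofinite, φ • p.toMap x = φ' • p.toMap x) : φ = φ' := by
  obtain ⟨M, rfl⟩ := Matrix.ProjGenLinGroup.mk_surjective φ
  obtain ⟨M', rfl⟩ := Matrix.ProjGenLinGroup.mk_surjective φ'
  simp only [← toMap_postcomp] at h
  obtain ⟨c, hc, hM⟩ := exists_coord_eq_C_mul_of_eventually_toMap_eq h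
  refine (Matrix.ProjGenLinGroup.mk_eq_mk_iff.2 ⟨Units.mk0 c hc, Matrix.GeneralLinearGroup.ext
    fun i j => ?_⟩).symm
  have hrow : ∑ j, (c * M' i j) • p.coord j = ∑ j, M i j • p.coord j := by
    simpa only [postcomp, smul_eq_C_mul, C_mul, mul_assoc, Finset.mul_sum] using (hM i).symm
  have hij : c * M' i j = M i j := congrFun (hp.fintypeLinearCombination_injective hrow) j
  rw [Matrix.GeneralLinearGroup.coe_mul, Matrix.GeneralLinearGroup.coe_scalar, Matrix.scalar_apply,
    Matrix.mul_diagonal, Units.val_mk0, mul_comm, hij]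

end ProjLineMorphism

section CommonRoot

lemma exists_dvd_C_leadingCoeff_pow_mul {R : Type*} [CommRing R] [IsDomain R]
    {J : Ideal (Polynomial R)} (hJ : J ≠ ⊥) :
    ∃ g ∈ J, g ≠ 0 ∧ ∀ f ∈ J, ∃ N : ℕ, g ∣ Polynomial.C (g.leadingCoeff ^ N) * f := by
  obtain ⟨g, ⟨hgJ, hg0⟩, hmin⟩ := WellFounded.has_min
    (measure (Polynomial.natDegree (R := R))).wf {f | f ∈ J ∧ f ≠ 0} (J.ne_bot_iff.1 hJ)
  refine ⟨g, hgJ, hg0, fun f => ?_⟩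
  induction hk : f.degree using WellFoundedLT.induction generalizing f with
  | ind k ih =>
    intro hfJ
    by_cases hf0 : f = 0
    · exact ⟨0, by simp [hf0]⟩
    have hle : g.natDegree ≤ f.natDegree := not_lt.1 (hmin f ⟨hfJ, hf0⟩)
    set f' := Polynomial.C g.leadingCoeff * f -
      Polynomial.C f.leadingCoeff * Polynomial.X ^ (f.natDegree - g.natDegree) * g with hf'
    have hf'J : f' ∈ J := J.sub_mem (J.mul_mem_left _ hfJ) (J.mul_mem_left _ hgJ)
    have hlg : g.leadingCoeff ≠ 0 := Polynomial.leadingCoeff_ne_zero.2 hg0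
    have hdeg : f'.degree < f.degree := by
      have hlf : f.leadingCoeff ≠ 0 := Polynomial.leadingCoeff_ne_zero.2 hf0
      rw [hf', ← Polynomial.degree_C_mul (p := f) hlg]
      refine Polynomial.degree_sub_lt_left ?_ (mul_ne_zero (Polynomial.C_ne_zero.2 hlg) hf0) ?_
      · rw [Polynomial.degree_C_mul hlg, mul_assoc, Polynomial.degree_C_mul hlf,
          Polynomial.degree_mul, Polynomial.degree_X_pow, Polynomial.degree_eq_natDegree hf0,
          Polynomial.degree_eq_natDegree hg0, ← Nat.cast_add, Nat.sub_add_cancel hle]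
      · simp only [Polynomial.leadingCoeff_mul, Polynomial.leadingCoeff_C,
          Polynomial.leadingCoeff_X_pow, mul_one]
        exact mul_comm _ _
    obtain ⟨N, hN⟩ := ih _ (hk ▸ hdeg) f' rfl hf'J
    refine ⟨N + 1, ?_⟩
    have hsplit : Polynomial.C (g.leadingCoeff ^ (N + 1)) * f =
        Polynomial.C (g.leadingCoeff ^ N) * f' + Polynomial.C (g.leadingCoeff ^ N) *
          (Polynomial.C f.leadingCoeff * Polynomial.X ^ (f.natDegree - g.natDegree)) * g := by
      rw [hf', pow_succ, Polynomial.C_mul]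
      ring
    exact hsplit ▸ dvd_add hN (Dvd.intro_left _ rfl)

lemma exists_mem_forall_eval₂_eq_zero {R K : Type*} [CommRing R] [IsDomain R] [CommRing K]
    [IsDomain K] {J : Ideal (Polynomial R)} (hJ : J ≠ ⊥) :
    ∃ g ∈ J, g ≠ 0 ∧ ∀ (σ : R →+* K) (z : K), σ g.leadingCoeff ≠ 0 → g.eval₂ σ z = 0 →
      ∀ f ∈ J, f.eval₂ σ z = 0 := by
  obtain ⟨g, hgJ, hg0, hdvd⟩ := exists_dvd_C_leadingCoeff_pow_mul hJ
  refine ⟨g, hgJ, hg0, fun σ z hlead hz f hf => ?_⟩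
  obtain ⟨N, k, hk⟩ := hdvd f hf
  have hσ : σ (g.leadingCoeff ^ N) * f.eval₂ σ z = 0 := by
    rw [← Polynomial.eval₂_C σ z, ← Polynomial.eval₂_mul, hk, Polynomial.eval₂_mul, hz, zero_mul]
  exact (mul_eq_zero.1 hσ).resolve_left (map_pow σ g.leadingCoeff N ▸ pow_ne_zero N hlead)

variable {K : Type*} [Field K]

lemma eventually_eval_ne_zero {f : Polynomial K} (hf : f ≠ 0) :
    ∀ᶠ u in Filter.cofinite, f.eval u ≠ 0 := by
  simpa [Filter.eventually_cofinite] using Polynomial.finite_setOfPred_isRoot hf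

lemma eq_neg_nextCoeff_div_of_unique_root [CharZero K] {f : Polynomial K} {y : K} (hf : f.Splits)
    (hf0 : f ≠ 0) (hy : f.eval y = 0) (huniq : ∀ z, f.eval z = 0 → z = y) :
    f.natDegree ≠ 0 ∧ y = -f.nextCoeff / (f.natDegree * f.leadingCoeff) := by
  have hdeg : f.natDegree ≠ 0 :=
    (Polynomial.natDegree_pos_iff_degree_pos.2 (Polynomial.degree_pos_of_root hf0 hy)).ne'
  have hroots : f.roots = Multiset.replicate f.natDegree y :=
    Multiset.eq_replicate.2 ⟨hf.natDegree_eq_card_roots.symm,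
      fun z hz => huniq z (Polynomial.isRoot_of_mem_roots hz)⟩
  have hlead : f.leadingCoeff ≠ 0 := Polynomial.leadingCoeff_ne_zero.2 hf0
  have hdegK : (f.natDegree : K) ≠ 0 := Nat.cast_ne_zero.2 hdeg
  refine ⟨hdeg, ?_⟩
  rw [hf.nextCoeff_eq_neg_sum_roots_mul_leadingCoeff, hroots, Multiset.sum_replicate,
    nsmul_eq_mul]
  field_simp

lemma eq_neg_map_nextCoeff_div_of_unique_root {R : Type*} [CommRing R] [IsAlgClosed K] [CharZero K]
    {σ : R →+* K} {g : Polynomial R} {y : K} (hlead : σ g.leadingCoeff ≠ 0)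
    (hy : g.eval₂ σ y = 0) (huniq : ∀ z, g.eval₂ σ z = 0 → z = y) :
    g.natDegree ≠ 0 ∧ y = -σ g.nextCoeff / (g.natDegree * σ g.leadingCoeff) := by
  have hmap : g.map σ ≠ 0 := fun h0 => hlead <| by
    rw [← Polynomial.leadingCoeff_map_of_leadingCoeff_ne_zero σ hlead, h0,
      Polynomial.leadingCoeff_zero]
  simp only [← Polynomial.eval_map] at hy huniq
  simpa only [Polynomial.natDegree_map_of_leadingCoeff_ne_zero σ hlead,
    Polynomial.leadingCoeff_map_of_leadingCoeff_ne_zero σ hlead,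
    Polynomial.nextCoeff_map_of_leadingCoeff_ne_zero σ hlead] using
    eq_neg_nextCoeff_div_of_unique_root (IsAlgClosed.splits (g.map σ)) hmap hy huniq

lemma exists_isCoprime_eval_div_eq {α β : Polynomial K} (hβ : β ≠ 0) :
    ∃ α' β' : Polynomial K, IsCoprime α' β' ∧ ∀ u, β.eval u ≠ 0 →
      β'.eval u ≠ 0 ∧ α.eval u / β.eval u = α'.eval u / β'.eval u := by
  classical
  have hg : gcd α β ≠ 0 := fun h0 => hβ ((gcd_eq_zero_iff α β).1 h0).2
  refine ⟨α / gcd α β, β / gcd α β, isCoprime_div_gcd_div_gcd hβ, fun u hu => ?_⟩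
  have hα' := congrArg (Polynomial.eval u) (EuclideanDomain.mul_div_cancel' hg (gcd_dvd_left α β))
  have hβ' := congrArg (Polynomial.eval u) (EuclideanDomain.mul_div_cancel' hg (gcd_dvd_right α β))
  rw [Polynomial.eval_mul] at hα' hβ'
  rw [← hβ'] at hu
  exact ⟨right_ne_zero_of_mul hu,
    by rw [← hα', ← hβ', mul_div_mul_left _ _ (left_ne_zero_of_mul hu)]⟩

/-- For generic `u` the polynomials in `S` have the same common roots as a single polynomial `g` of
least degree in the ideal they generate. If there is only one such root, it is the mean of the roots
of `g` and so can be read off from the two highest coefficients of `g`. -/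
theorem exists_isCoprime_forall_eval₂_div_eq_zero [IsAlgClosed K] [CharZero K]
    {S : Set (Polynomial (Polynomial K))} (h : ∀ᶠ u in Filter.cofinite,
      ∃! y, ∀ f ∈ S, f.eval₂ (Polynomial.evalRingHom u) y = 0) :
    ∃ α β : Polynomial K, IsCoprime α β ∧ ∀ᶠ u in Filter.cofinite, β.eval u ≠ 0 ∧
      ∀ f ∈ S, f.eval₂ (Polynomial.evalRingHom u) (α.eval u / β.eval u) = 0 := by
  have hspan : ∀ u y, (∀ f ∈ S, f.eval₂ (Polynomial.evalRingHom u) y = 0) ↔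
      ∀ f ∈ Ideal.span S, f.eval₂ (Polynomial.evalRingHom u) y = 0 := fun u y =>
    (Ideal.span_le (I := RingHom.ker (Polynomial.eval₂RingHom (Polynomial.evalRingHom u) y))).symm
  simp only [hspan] at h ⊢
  set J := Ideal.span S
  have hJ : J ≠ ⊥ := fun hJ => by
    obtain ⟨u, y, -, hy⟩ := h.exists
    have hall : ∀ z, z = y := fun z => hy z fun f hf => by
      rw [(Submodule.mem_bot _).1 (show f ∈ ⊥ from hJ ▸ hf), Polynomial.eval₂_zero]
    exact one_ne_zero ((hall 1).trans (hall 0).symm)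
  obtain ⟨g, hgJ, hg0, hgroot⟩ := exists_mem_forall_eval₂_eq_zero (K := K) hJ
  have hlg := Polynomial.leadingCoeff_ne_zero.2 hg0
  have hroot : ∀ᶠ u in Filter.cofinite, g.natDegree ≠ 0 ∧
      ∀ f ∈ J, f.eval₂ (Polynomial.evalRingHom u)
        (-(g.nextCoeff.eval u) / (g.natDegree * g.leadingCoeff.eval u)) = 0 := by
    filter_upwards [h, eventually_eval_ne_zero hlg] with u ⟨y, hy, huniq⟩ hu
    obtain ⟨hdeg, rfl⟩ := eq_neg_map_nextCoeff_div_of_unique_root (σ := Polynomial.evalRingHom u)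
      hu (hy g hgJ) fun z hz => huniq z (hgroot _ z hu hz)
    exact ⟨hdeg, hy⟩
  obtain ⟨u, hm, -⟩ := hroot.exists
  have hβ : Polynomial.C (g.natDegree : K) * g.leadingCoeff ≠ 0 :=
    mul_ne_zero (Polynomial.C_ne_zero.2 (Nat.cast_ne_zero.2 hm)) hlg
  obtain ⟨α, β, hcop, heq⟩ := exists_isCoprime_eval_div_eq (α := -g.nextCoeff) hβ
  refine ⟨α, β, hcop, ?_⟩
  filter_upwards [hroot, eventually_eval_ne_zero hβ] with u hu hβu
  obtain ⟨hβ', hαβ⟩ := heq u hβu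
  rw [← hαβ, Polynomial.eval_neg, Polynomial.eval_mul, Polynomial.eval_C]
  exact ⟨hβ', hu.2⟩

end CommonRoot

section PolynomialPairs

lemma coeff_aeval_of_natDegree_le {R : Type*} [CommRing R] {d e : ℕ}
    {f : MvPolynomial (Fin 2) R} (hf : f.IsHomogeneous d) {a : Fin 2 → Polynomial R}
    (ha : ∀ i, (a i).natDegree ≤ e) :
    (aeval a f).natDegree ≤ d * e ∧
      (aeval a f).coeff (d * e) = eval (fun i => (a i).coeff e) f := by
  have hterm : ∀ m ∈ f.support, (aeval a (monomial m (coeff m f))).natDegree ≤ d * e ∧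
      (aeval a (monomial m (coeff m f))).coeff (d * e) =
        eval (fun i => (a i).coeff e) (monomial m (coeff m f)) := by
    intro m hm
    have hd : d = m 0 + m 1 := by
      rw [← hf (mem_support_iff.1 hm), Finsupp.weight_apply, Finsupp.sum_fintype _ _ (by simp)]
      simp
    have hprod : aeval a (monomial m (coeff m f)) =
        Polynomial.C (coeff m f) * (a 0 ^ m 0 * a 1 ^ m 1) := by
      rw [aeval_monomial, Finsupp.prod_fintype _ _ (by simp), Fin.prod_univ_two,
        Polynomial.algebraMap_eq]
    have h0 := Polynomial.natDegree_pow_le_of_le (m 0) (ha 0)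
    have h1 := Polynomial.natDegree_pow_le_of_le (m 1) (ha 1)
    rw [hprod, hd, add_mul]
    refine ⟨(Polynomial.natDegree_C_mul_le _ _).trans (Polynomial.natDegree_mul_le_of_le h0 h1), ?_⟩
    rw [Polynomial.coeff_C_mul, Polynomial.coeff_mul_add_eq_of_natDegree_le h0 h1,
      Polynomial.coeff_pow_of_natDegree_le (ha 0), Polynomial.coeff_pow_of_natDegree_le (ha 1),
      eval_monomial, Finsupp.prod_fintype _ _ (by simp), Fin.prod_univ_two]
  rw [f.as_sum]
  simp only [map_sum, Polynomial.finsetSum_coeff]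
  exact ⟨Polynomial.natDegree_sum_le_of_forall_le _ _ fun m hm => (hterm m hm).1,
    Finset.sum_congr rfl fun m hm => (hterm m hm).2⟩

lemma exists_coeff_sup_natDegree_ne_zero {ι R : Type*} [Fintype ι] [Semiring R]
    {a : ι → Polynomial R} (ha : a ≠ 0) :
    ∃ i, (a i).coeff (Finset.univ.sup fun j => (a j).natDegree) ≠ 0 := by
  obtain ⟨k, hk : a k ≠ 0⟩ := Function.ne_iff.1 ha
  obtain ⟨i, -, hi⟩ :=
    Finset.exists_max_image Finset.univ (fun j => (a j).degree) ⟨k, Finset.mem_univ k⟩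
  have hi0 : a i ≠ 0 := fun h0 => hk <| by
    simpa only [h0, Polynomial.degree_zero, le_bot_iff, Polynomial.degree_eq_bot] using
      hi k (Finset.mem_univ k)
  have hsup : (Finset.univ.sup fun j => (a j).natDegree) = (a i).natDegree :=
    le_antisymm (Finset.sup_le fun j hj => Polynomial.natDegree_le_natDegree (hi j hj))
      (Finset.le_sup (f := fun j => (a j).natDegree) (Finset.mem_univ i))
  exact ⟨i, by rwa [hsup, Polynomial.coeff_natDegree, Polynomial.leadingCoeff_ne_zero]⟩

lemma exists_GL_eq_C_mul_X_add_C {K : Type*} [Field K] {a : Fin 2 → Polynomial K}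
    (ha : IsCoprime (a 0) (a 1)) (hdeg : (Finset.univ.sup fun i => (a i).natDegree) = 1) :
    ∃ A : GL (Fin 2) K,
      ∀ i, a i = Polynomial.C (A i 0) * Polynomial.X + Polynomial.C (A i 1) := by
  have hX : ∀ i, a i = Polynomial.C ((a i).coeff 1) * Polynomial.X +
      Polynomial.C ((a i).coeff 0) := fun i => Polynomial.eq_X_add_C_of_natDegree_le_one
    ((Finset.le_sup (f := fun i => (a i).natDegree) (Finset.mem_univ i)).trans_eq hdeg)
  let M : Matrix (Fin 2) (Fin 2) K := Matrix.of fun i => ![(a i).coeff 1, (a i).coeff 0]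
  suffices hM : M.det ≠ 0 from ⟨Matrix.GeneralLinearGroup.mkOfDetNeZero M hM, hX⟩
  intro hM
  rw [Matrix.det_fin_two, sub_eq_zero] at hM
  have hprop : Polynomial.C ((a 1).coeff 1) * a 0 = Polynomial.C ((a 0).coeff 1) * a 1 := by
    have hC : Polynomial.C ((a 0).coeff 1) * Polynomial.C ((a 1).coeff 0) =
        Polynomial.C ((a 0).coeff 0) * Polynomial.C ((a 1).coeff 1) := by
      rw [← Polynomial.C_mul, ← Polynomial.C_mul]
      exact congrArg Polynomial.C hM
    linear_combination Polynomial.C ((a 1).coeff 1) * hX 0 -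
      Polynomial.C ((a 0).coeff 1) * hX 1 - hC
  have hdvd : ∀ i, a i ∣ Polynomial.C ((a i).coeff 1) := Fin.forall_fin_two.2
    ⟨ha.dvd_of_dvd_mul_right (hprop ▸ dvd_mul_left _ _),
      ha.symm.dvd_of_dvd_mul_right (hprop ▸ dvd_mul_left _ _)⟩
  obtain ⟨i, hi⟩ := exists_coeff_sup_natDegree_ne_zero ha.ne_zero
  rw [hdeg] at hi
  have hi0 := Polynomial.natDegree_le_of_dvd (hdvd i) (Polynomial.C_ne_zero.2 hi)
  rw [Polynomial.natDegree_C] at hi0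
  exact hi (Polynomial.coeff_eq_zero_of_natDegree_lt (Nat.lt_succ_of_le hi0))

lemma dehomogenize_substForm {A : GL (Fin 2) ℂ} {a : Fin 2 → Polynomial ℂ}
    (ha : ∀ i, a i = Polynomial.C (A i 0) * Polynomial.X + Polynomial.C (A i 1)) (G : BinPoly) :
    dehomogenize (substForm A G) = aeval a G := by
  have h : (dehomogenize : BinPoly →ₐ[ℂ] Polynomial ℂ).comp
      (aeval fun i : Fin 2 => ∑ j : Fin 2, C (A i j) * (X j : BinPoly)) = aeval a := by
    ext1 i
    simp [dehomogenize, ha, Fin.sum_univ_two]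
  exact DFunLike.congr_fun h G

end PolynomialPairs

namespace ProjLineMorphism

variable {n d : ℕ}

lemma isUnit_of_forall_dvd_aeval (p : ProjLineMorphism n d) {a : Fin 2 → Polynomial ℂ}
    (ha : IsCoprime (a 0) (a 1)) {f : Polynomial ℂ} (hf : ∀ i, f ∣ aeval a (p.coord i)) :
    IsUnit f := by
  refine Polynomial.isUnit_iff_degree_eq_zero.2 (by_contra fun hdeg => ?_)
  obtain ⟨x, hx⟩ := IsAlgClosed.exists_root f hdeg
  have hax : (fun i => (a i).eval x) ≠ 0 :=
    IsCoprime.ne_zero (ha.map (Polynomial.evalRingHom x))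
  refine p.vec_ne_zero hax (funext fun i => ?_)
  rw [vec, ← eval_aeval_polynomial]
  exact Polynomial.eval_eq_zero_of_dvd_of_eval_eq_zero (hf i) hx

lemma isUnit_of_forall_dvd_dehomogenize (p : ProjLineMorphism n d) {f : Polynomial ℂ}
    (hf : ∀ i, f ∣ dehomogenize (p.coord i)) : IsUnit f :=
  p.isUnit_of_forall_dvd_aeval (a := ![Polynomial.X, 1]) isCoprime_one_right hf

lemma sup_natDegree_aeval (p : ProjLineMorphism n d) {a : Fin 2 → Polynomial ℂ} (ha : a ≠ 0) :
    (Finset.univ.sup fun i => (aeval a (p.coord i)).natDegree) =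
      d * Finset.univ.sup fun i => (a i).natDegree := by
  have hle : ∀ i, (a i).natDegree ≤ Finset.univ.sup fun i => (a i).natDegree := fun i =>
    Finset.le_sup (f := fun i => (a i).natDegree) (Finset.mem_univ i)
  have hcoeff := fun i => coeff_aeval_of_natDegree_le (p.isHomogeneous i) hle
  refine le_antisymm (Finset.sup_le fun i _ => (hcoeff i).1) ?_
  obtain ⟨k, hk⟩ := exists_coeff_sup_natDegree_ne_zero ha
  have htop : (fun i => (a i).coeff (Finset.univ.sup fun j => (a j).natDegree)) ≠ 0 :=
    Function.ne_iff.2 ⟨k, hk⟩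
  obtain ⟨i, hi⟩ := Function.ne_iff.1 (p.vec_ne_zero htop)
  exact (Polynomial.le_natDegree_of_ne_zero ((hcoeff i).2.trans_ne hi)).trans
    (Finset.le_sup (f := fun i => (aeval a (p.coord i)).natDegree) (Finset.mem_univ i))

lemma sup_natDegree_dehomogenize (p : ProjLineMorphism n d) :
    (Finset.univ.sup fun i => (dehomogenize (p.coord i)).natDegree) = d := by
  have hX : (![Polynomial.X, 1] : Fin 2 → Polynomial ℂ) ≠ 0 :=
    Function.ne_iff.2 ⟨1, one_ne_zero⟩
  have hsup : (Finset.univ.sup fun i => (![Polynomial.X, 1] i : Polynomial ℂ).natDegree) = 1 := by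
    simp [Fin.univ_succ]
  have haeval := p.sup_natDegree_aeval hX
  rwa [hsup, mul_one] at haeval

variable {r q : ProjLineMorphism n d}

lemma eventually_existsUnique_toMap_affinePoint_eq (hr : GenericallyInjective r.toMap)
    (hq : GenericallyInjective q.toMap) (h : Set.range r.toMap ⊆ Set.range q.toMap) :
    ∀ᶠ u in Filter.cofinite, ∃! y, r.toMap (affinePoint u) = q.toMap (affinePoint y) := by
  refine (hr.comp_injective affinePoint_injective).eventually_existsUnique_eq
    (hq.comp_injective affinePoint_injective)
    ((finite_compl_range_affinePoint.image q.toMap).subset ?_)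
  rintro _ ⟨⟨u, rfl⟩, hu⟩
  obtain ⟨x, hx⟩ := h ⟨affinePoint u, rfl⟩
  exact ⟨x, fun ⟨y, hy⟩ => hu ⟨y, by simp only [Function.comp_apply, hy, hx]⟩, hx⟩

lemma exists_isCoprime_eventually_toMap_affinePoint_eq (hr : GenericallyInjective r.toMap)
    (hq : GenericallyInjective q.toMap) (h : Set.range r.toMap ⊆ Set.range q.toMap) :
    ∃ α β : Polynomial ℂ, IsCoprime α β ∧ ∀ᶠ u in Filter.cofinite, β.eval u ≠ 0 ∧
      r.toMap (affinePoint u) = q.toMap (affinePoint (α.eval u / β.eval u)) := by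
  let S : Set (Polynomial (Polynomial ℂ)) := Set.range fun ij : Fin (n + 1) × Fin (n + 1) =>
    Polynomial.C (dehomogenize (r.coord ij.1)) * (dehomogenize (q.coord ij.2)).map Polynomial.C -
      Polynomial.C (dehomogenize (r.coord ij.2)) * (dehomogenize (q.coord ij.1)).map Polynomial.C
  have hS : ∀ u y, (∀ f ∈ S, f.eval₂ (Polynomial.evalRingHom u) y = 0) ↔
      r.toMap (affinePoint u) = q.toMap (affinePoint y) := fun u y => by
    have hid : (Polynomial.evalRingHom u).comp Polynomial.C = RingHom.id ℂ := by
      ext; simp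
    simp only [S, Set.forall_mem_range, Prod.forall, toMap_affinePoint_eq_iff,
      Polynomial.eval₂_sub, Polynomial.eval₂_mul, Polynomial.eval₂_C, Polynomial.eval₂_map, hid,
      Polynomial.eval₂_id, Polynomial.coe_evalRingHom, sub_eq_zero]
  simpa only [hS] using exists_isCoprime_forall_eval₂_div_eq_zero (S := S)
    (by simpa only [hS] using eventually_existsUnique_toMap_affinePoint_eq hr hq h)

lemma exists_dehomogenize_coord_eq_C_mul_aeval (hr : GenericallyInjective r.toMap)
    (hq : GenericallyInjective q.toMap) (h : Set.range r.toMap ⊆ Set.range q.toMap) :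
    ∃ (a : Fin 2 → Polynomial ℂ) (c : ℂ), IsCoprime (a 0) (a 1) ∧ c ≠ 0 ∧ ∀ i,
      dehomogenize (r.coord i) = Polynomial.C c * aeval a (q.coord i) := by
  obtain ⟨α, β, hαβ, hev⟩ := exists_isCoprime_eventually_toMap_affinePoint_eq hr hq h
  have hcross : ∀ i j, dehomogenize (r.coord i) * aeval ![α, β] (q.coord j) =
      dehomogenize (r.coord j) * aeval ![α, β] (q.coord i) := fun i j => by
    refine Polynomial.eq_of_infinite_eval_eq _ _ (Filter.frequently_cofinite_iff_infinite.1
      (Filter.Eventually.frequently ?_))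
    filter_upwards [hev] with u ⟨hβ, hu⟩
    have hv : (fun k => (![α, β] k).eval u) ≠ 0 := Function.ne_iff.2 ⟨1, hβ⟩
    have hmk : r.toMap (affinePoint u) = q.toMap (Projectivization.mk ℂ _ hv) :=
      hu.trans (congrArg q.toMap (mk_eq_affinePoint_div hv hβ).symm)
    simp only [Polynomial.eval_mul, eval_dehomogenize, eval_aeval_polynomial]
    exact (projectivization_mk_eq_mk_iff_cross _ _).1 hmk i j
  obtain ⟨f, hf, hrq⟩ := exists_isUnit_eq_mul_of_cross_mul_eq
    (fun _ => q.isUnit_of_forall_dvd_aeval (a := ![α, β]) hαβ)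
    (fun _ => r.isUnit_of_forall_dvd_dehomogenize) hcross
  obtain ⟨c, hc, rfl⟩ := Polynomial.isUnit_iff.1 hf
  exact ⟨![α, β], c, hαβ, hc.ne_zero, hrq⟩

theorem exists_coord_eq_C_mul_substForm (hd : d ≠ 0) (hr : GenericallyInjective r.toMap)
    (hq : GenericallyInjective q.toMap) (h : Set.range r.toMap ⊆ Set.range q.toMap) :
    ∃ (A : GL (Fin 2) ℂ) (c : ℂ), c ≠ 0 ∧ ∀ i, r.coord i = C c * substForm A (q.coord i) := by
  obtain ⟨a, c, ha, hc, hra⟩ := exists_dehomogenize_coord_eq_C_mul_aeval hr hq h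
  have hdeg : (Finset.univ.sup fun i => (a i).natDegree) = 1 := by
    have hsup := r.sup_natDegree_dehomogenize
    simp only [hra, Polynomial.natDegree_C_mul hc, q.sup_natDegree_aeval ha.ne_zero] at hsup
    exact (mul_eq_left₀ hd).1 hsup
  obtain ⟨A, hA⟩ := exists_GL_eq_C_mul_X_add_C ha hdeg
  refine ⟨A, c, hc, fun i => eq_of_dehomogenize_eq (r.isHomogeneous i)
    ((isHomogeneous_substForm A (q.isHomogeneous i)).C_mul c) ?_⟩
  rw [hra, map_mul, dehomogenize_substForm hA, ← algebraMap_eq, AlgHom.commutes,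
    Polynomial.algebraMap_eq]

end ProjLineMorphism

section TopPartials

lemma commute_pderiv {σ R : Type*} [CommRing R] (i j : σ) :
    Function.Commute (pderiv (R := R) i) (pderiv j) := by
  classical
  have h : ⁅pderiv (R := R) i, pderiv j⁆ = 0 := derivation_ext fun k => by
    rw [Derivation.commutator_apply, pderiv_X, pderiv_X, Pi.single_apply, Pi.single_apply]
    split_ifs <;> simp
  exact fun f => sub_eq_zero.1 (by rw [← Derivation.commutator_apply, h, Derivation.zero_apply])

variable {R : Type*} [CommRing R]

/-- The constant terms of the partial derivatives `∂ᴺf/∂sᴺ⁻ʲ∂tʲ`, `j = 0, …, N`. For a form of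
degree `N` these are its coefficients, scaled by `(N - j)! j!`; unlike the coefficients they are
permuted by differentiation without further factors. -/
def topPartials (N : ℕ) : MvPolynomial (Fin 2) R →ₗ[R] (Fin (N + 1) → R) :=
  LinearMap.pi fun j => lcoeff R 0 ∘ₗ
    ((pderiv 0).toLinearMap ^ (N - (j : ℕ))) ∘ₗ ((pderiv 1).toLinearMap ^ (j : ℕ))

lemma topPartials_apply (N : ℕ) (f : MvPolynomial (Fin 2) R) (j : Fin (N + 1)) :
    topPartials N f j = coeff 0 ((pderiv 0)^[N - (j : ℕ)] ((pderiv 1)^[(j : ℕ)] f)) := by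
  simp only [topPartials, LinearMap.pi_apply, LinearMap.comp_apply, Module.End.pow_apply]
  rfl

lemma topPartials_pderiv_zero (N : ℕ) (f : MvPolynomial (Fin 2) R) (j : Fin (N + 1)) :
    topPartials N (pderiv 0 f) j = topPartials (N + 1) f j.castSucc := by
  rw [topPartials_apply, topPartials_apply, Fin.val_castSucc,
    show N + 1 - (j : ℕ) = N - j + 1 by lia, Function.iterate_succ_apply,
    (commute_pderiv 1 0).iterate_left]

lemma topPartials_pderiv_one (N : ℕ) (f : MvPolynomial (Fin 2) R) (j : Fin (N + 1)) :
    topPartials N (pderiv 1 f) j = topPartials (N + 1) f j.succ := by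
  rw [topPartials_apply, topPartials_apply, Fin.val_succ, Nat.add_sub_add_right,
    Function.iterate_succ_apply]

lemma isHomogeneous_iterate_pderiv {σ : Type*} {f : MvPolynomial σ R} {d : ℕ}
    (hf : f.IsHomogeneous d) (i : σ) (k : ℕ) : ((pderiv i)^[k] f).IsHomogeneous (d - k) := by
  induction k with
  | zero => exact hf
  | succ k ih =>
    rw [Function.iterate_succ_apply', ← Nat.sub_sub]
    exact ih.pderiv

lemma eq_C_of_isHomogeneous_zero {σ : Type*} {f : MvPolynomial σ R} (hf : f.IsHomogeneous 0) :
    f = C (coeff 0 f) :=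
  totalDegree_eq_zero_iff_eq_C.1 (((totalDegree_zero_iff_isHomogeneous _).2 hf))

/-- Euler's identity for the linear form on the left. -/
lemma iterate_pderiv_eq_topPartials {n : ℕ} {f : MvPolynomial (Fin 2) R}
    (hf : f.IsHomogeneous (n + 1)) (k : Fin (n + 1)) :
    (pderiv 0)^[n - (k : ℕ)] ((pderiv 1)^[(k : ℕ)] f) =
      C (topPartials (n + 1) f k.castSucc) * X 0 + C (topPartials (n + 1) f k.succ) * X 1 := by
  set g := (pderiv 0)^[n - (k : ℕ)] ((pderiv 1)^[(k : ℕ)] f)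
  have hg : g.IsHomogeneous 1 := by
    convert isHomogeneous_iterate_pderiv (isHomogeneous_iterate_pderiv hf 1 k) 0 (n - k)
    lia
  have h0 : coeff 0 (pderiv 0 g) = topPartials (n + 1) f k.castSucc := by
    rw [topPartials_apply, Fin.val_castSucc, show n + 1 - (k : ℕ) = n - k + 1 by lia,
      Function.iterate_succ_apply']
  have h1 : coeff 0 (pderiv 1 g) = topPartials (n + 1) f k.succ := by
    rw [topPartials_apply, Fin.val_succ, Nat.add_sub_add_right, Function.iterate_succ_apply',
      (commute_pderiv 1 0).iterate_right]
  have hEuler := hg.sum_X_mul_pderiv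
  rw [Fin.sum_univ_two, one_nsmul] at hEuler
  rw [← h0, ← h1, ← eq_C_of_isHomogeneous_zero hg.pderiv,
    ← eq_C_of_isHomogeneous_zero hg.pderiv]
  linear_combination -hEuler

lemma eq_zero_of_topPartials_eq_zero [IsDomain R] [CharZero R] {N : ℕ}
    {f : MvPolynomial (Fin 2) R} (hf : f.IsHomogeneous N) (h : topPartials N f = 0) : f = 0 := by
  induction N generalizing f with
  | zero =>
    rw [eq_C_of_isHomogeneous_zero hf, ← C_0]
    exact congrArg C (congrFun h 0)
  | succ N ih =>
    have h0 : pderiv 0 f = 0 := ih hf.pderiv (funext fun j => by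
      rw [topPartials_pderiv_zero, h, Pi.zero_apply, Pi.zero_apply])
    have h1 : pderiv 1 f = 0 := ih hf.pderiv (funext fun j => by
      rw [topPartials_pderiv_one, h, Pi.zero_apply, Pi.zero_apply])
    have hEuler := hf.sum_X_mul_pderiv
    rw [Fin.sum_univ_two, h0, h1, mul_zero, mul_zero, add_zero] at hEuler
    exact (smul_eq_zero_iff_right N.succ_ne_zero).1 hEuler.symm

lemma injOn_topPartials [IsDomain R] [CharZero R] (N : ℕ) :
    Set.InjOn (topPartials (R := R) N) (homogeneousSubmodule (Fin 2) R N) := fun f hf g hg h =>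
  sub_eq_zero.1 (eq_zero_of_topPartials_eq_zero (hf.sub hg) (by rw [map_sub, h, sub_self]))

end TopPartials

section LinearForm

variable {R : Type*} [CommRing R]

/-- The linear form `v₁ s - v₀ t`, which vanishes at the point `[v₀ : v₁]`. -/
def linearForm (v : Fin 2 → R) : MvPolynomial (Fin 2) R :=
  C (v 1) * X 0 - C (v 0) * X 1

lemma isHomogeneous_linearForm_pow (v : Fin 2 → R) (N : ℕ) :
    (linearForm v ^ N).IsHomogeneous N := by
  simpa only [linearForm, one_mul] using
    ((isHomogeneous_C_mul_X (v 1) 0).sub (isHomogeneous_C_mul_X (v 0) 1)).pow N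

lemma iterate_pderiv_pow {σ : Type*} {L : MvPolynomial σ R} {i : σ} {c : R}
    (hL : pderiv i L = C c) (N k : ℕ) :
    (pderiv i)^[k] (L ^ N) = C (N.descFactorial k * c ^ k) * L ^ (N - k) := by
  induction k with
  | zero => simp
  | succ k ih =>
    rw [Function.iterate_succ_apply', ih, pderiv_C_mul, pderiv_pow, hL, Nat.sub_sub,
      Nat.descFactorial_succ]
    simp only [Nat.cast_mul, C_mul, pow_succ, map_natCast]
    ring

lemma topPartials_linearForm_pow (v : Fin 2 → R) (N : ℕ) :
    topPartials N (linearForm v ^ N) =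
      (N.factorial : R) • fun j : Fin (N + 1) => v 1 ^ (N - (j : ℕ)) * (-v 0) ^ (j : ℕ) := by
  have h0 : pderiv 0 (linearForm v) = C (v 1) := by simp [linearForm, pderiv_X]
  have h1 : pderiv 1 (linearForm v) = C (-v 0) := by simp [linearForm, pderiv_X]
  funext j
  have hC (a : R) (k : ℕ) (f : MvPolynomial (Fin 2) R) :
      (pderiv 0)^[k] (C a * f) = C a * (pderiv 0)^[k] f :=
    Function.Semiconj.iterate_right (f := (C a * ·)) (fun _ => pderiv_C_mul.symm) k f |>.symm
  rw [topPartials_apply, iterate_pderiv_pow h1, hC, iterate_pderiv_pow h0, Nat.sub_self, pow_zero,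
    mul_one, coeff_C_mul, coeff_zero_C, Nat.descFactorial_self, Pi.smul_apply, smul_eq_mul,
    ← Nat.factorial_mul_descFactorial (Nat.lt_succ_iff.1 j.2)]
  push_cast
  ring

variable {K : Type*} [Field K] [CharZero K]

lemma linearIndependent_linearForm_pow (N : ℕ) :
    LinearIndependent K fun i : Fin (N + 1) =>
      topPartials N (linearForm ![-(i : K), 1] ^ N) := by
  have h : LinearIndependent K (Matrix.vandermonde fun i : Fin (N + 1) => (i : K)).row :=
    Matrix.linearIndependent_rows_iff_isUnit.2 <| (Matrix.isUnit_iff_isUnit_det _).2 <|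
      isUnit_iff_ne_zero.2 <| Matrix.det_vandermonde_ne_zero_iff.2 fun i j hij =>
        Fin.ext (Nat.cast_injective hij)
  have hN : (N.factorial : K) ≠ 0 := Nat.cast_ne_zero.2 N.factorial_ne_zero
  convert h.units_smul fun _ => Units.mk0 _ hN using 1
  funext i
  rw [topPartials_linearForm_pow]
  funext j
  simp [Matrix.vandermonde, Units.smul_def]

lemma map_topPartials_span_linearForm_pow (N : ℕ) :
    (Submodule.span K (Set.range fun v : Fin 2 → K => linearForm v ^ N)).map (topPartials N) =
      ⊤ := by
  rw [Submodule.map_span, ← Set.range_comp, eq_top_iff,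
    ← (linearIndependent_linearForm_pow (K := K) N).span_eq_top_of_card_eq_finrank' (by simp)]
  exact Submodule.span_mono (Set.range_subset_iff.2 fun i => ⟨![-(i : K), 1], rfl⟩)

lemma span_range_linearForm_pow (N : ℕ) :
    Submodule.span K (Set.range fun v : Fin 2 → K => linearForm v ^ N) =
      homogeneousSubmodule (Fin 2) K N := by
  have hle : Submodule.span K (Set.range fun v : Fin 2 → K => linearForm v ^ N) ≤
      homogeneousSubmodule (Fin 2) K N :=
    Submodule.span_le.2 (Set.range_subset_iff.2 fun v => isHomogeneous_linearForm_pow v N)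
  refine le_antisymm hle fun f hf => ?_
  obtain ⟨g, hg, hgf⟩ := (map_topPartials_span_linearForm_pow (K := K) N).ge
    (Submodule.mem_top (x := topPartials N f))
  rwa [← injOn_topPartials N (hle hg) hf hgf]

lemma exists_isHomogeneous_topPartials_eq {N : ℕ} (b : Fin (N + 1) → K) :
    ∃ f : MvPolynomial (Fin 2) K, f.IsHomogeneous N ∧ topPartials N f = b := by
  obtain ⟨f, hf, hfb⟩ := (map_topPartials_span_linearForm_pow (K := K) N).ge
    (Submodule.mem_top (x := b))
  rw [span_range_linearForm_pow] at hf
  exact ⟨f, hf, hfb⟩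

lemma forall_isHomogeneous_eq_iff {E : Type*} [AddCommGroup E] [Module K E] {N : ℕ}
    {l l' : MvPolynomial (Fin 2) K →ₗ[K] E} :
    (∀ g, g.IsHomogeneous N → l g = l' g) ↔
      ∀ v, l (linearForm v ^ N) = l' (linearForm v ^ N) := by
  have h := LinearMap.eqOn_span_iff (f := l) (g := l')
    (s := Set.range fun v : Fin 2 → K => linearForm v ^ N)
  rw [span_range_linearForm_pow, Set.eqOn_range] at h
  exact h.trans funext_iff

end LinearForm

section DetSnoc

variable {R : Type*} [CommRing R] {N : ℕ}

/-- The determinant with rows `a₀, …, a_{N-1}, b` as a linear functional of the last row `b`. -/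
def detSnoc (a : Fin N → Fin (N + 1) → R) : (Fin (N + 1) → R) →ₗ[R] R :=
  Matrix.detRowAlternating.toMultilinearMap.curryRight a

lemma detSnoc_apply (a : Fin N → Fin (N + 1) → R) (b : Fin (N + 1) → R) :
    detSnoc a b = (Matrix.of (Fin.snoc a b : Fin (N + 1) → Fin (N + 1) → R)).det := rfl

lemma detSnoc_single_last (a : Fin N → Fin (N + 1) → R) (r : R) :
    detSnoc a (Pi.single (Fin.last N) r) = r * (Matrix.of fun i k => a i k.castSucc).det := by
  rw [detSnoc_apply, Matrix.det_succ_row _ (Fin.last N), Fin.sum_univ_castSucc,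
    Finset.sum_eq_zero fun k _ => by simp [(Fin.castSucc_lt_last k).ne], zero_add, Fin.val_last,
    ← two_mul, pow_mul, neg_one_sq, one_pow, one_mul]
  congr 1
  · simp
  · congr 1
    ext i k
    simp

/-- The lower bidiagonal matrix whose `k`-th column is `x e_k + y e_{k+1}` for `k < N` and `e_N`
for `k = N`. -/
def bidiagonal (N : ℕ) (x y : R) : Matrix (Fin (N + 1)) (Fin (N + 1)) R :=
  (Matrix.of (Fin.snoc (fun k : Fin N => Pi.single k.castSucc x + Pi.single k.succ y)
    (Pi.single (Fin.last N) 1) : Fin (N + 1) → Fin (N + 1) → R)).transpose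

lemma vecMul_bidiagonal (c : Fin (N + 1) → R) (x y : R) :
    Matrix.vecMul c (bidiagonal N x y) =
      Fin.snoc (α := fun _ => R) (fun k : Fin N => c k.castSucc * x + c k.succ * y)
        (c (Fin.last N)) := by
  funext k
  induction k using Fin.lastCases <;>
    simp [Matrix.vecMul, dotProduct, bidiagonal, Pi.single_apply, mul_add, Finset.sum_add_distrib]

lemma det_bidiagonal (x y : R) : (bidiagonal N x y).det = x ^ N := by
  rw [Matrix.det_of_isLowerTriangular, Fin.prod_univ_castSucc]
  · simp [bidiagonal, (Fin.castSucc_lt_succ).ne]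
  · intro i k hik
    rw [OrderDual.toDual_lt_toDual] at hik
    induction k using Fin.lastCases with
    | last => simp [bidiagonal, hik.ne]
    | cast k => simp [bidiagonal, hik.ne, (hik.trans Fin.castSucc_lt_succ).ne]

lemma detSnoc_mul_det (a : Fin N → Fin (N + 1) → R) (b : Fin (N + 1) → R)
    (T : Matrix (Fin (N + 1)) (Fin (N + 1)) R) :
    detSnoc a b * T.det = detSnoc (fun i => Matrix.vecMul (a i) T) (Matrix.vecMul b T) := by
  rw [detSnoc_apply, detSnoc_apply, ← Matrix.det_mul]
  congr 1
  ext i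
  induction i using Fin.lastCases <;> simp [Matrix.mul_apply, Matrix.vecMul, dotProduct]

lemma detSnoc_mul_pow (a : Fin N → Fin (N + 1) → R) (x y : R) :
    detSnoc a (fun j => y ^ (N - (j : ℕ)) * (-x) ^ (j : ℕ)) * x ^ N =
      (-x) ^ N * (Matrix.of fun i k : Fin N => a i k.castSucc * x + a i k.succ * y).det := by
  have hlast : Matrix.vecMul (fun j : Fin (N + 1) => y ^ (N - (j : ℕ)) * (-x) ^ (j : ℕ))
      (bidiagonal N x y) = Pi.single (Fin.last N) ((-x) ^ N) := by
    rw [vecMul_bidiagonal]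
    funext k
    induction k using Fin.lastCases with
    | last => simp
    | cast k =>
      rw [Fin.snoc_castSucc, Pi.single_eq_of_ne (Fin.castSucc_lt_last k).ne, Fin.val_castSucc,
        Fin.val_succ, show N - (k : ℕ) = N - (k + 1) + 1 by lia]
      ring
  rw [← det_bidiagonal x y, detSnoc_mul_det, hlast, detSnoc_single_last]
  simp only [vecMul_bidiagonal, Fin.snoc_castSucc]

lemma detSnoc_pow_mul_neg_pow (a : Fin N → Fin (N + 1) → R) (x y : R) :
    detSnoc a (fun j => y ^ (N - (j : ℕ)) * (-x) ^ (j : ℕ)) =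
      (-1) ^ N * (Matrix.of fun i k : Fin N => a i k.castSucc * x + a i k.succ * y).det := by
  -- With an indeterminate in place of `x`, the factor `x ^ N` can be cancelled.
  have h := detSnoc_mul_pow (fun i j => Polynomial.C (a i j)) Polynomial.X (Polynomial.C y)
  rw [neg_pow (Polynomial.X : Polynomial R), mul_right_comm] at h
  have h' := congrArg (Polynomial.evalRingHom x)
    ((Polynomial.monic_X_pow N).isRegular.right h)
  rw [detSnoc_apply, map_mul, RingHom.map_det, RingHom.map_det] at h'
  rw [detSnoc_apply]
  convert h' using 2
  · ext i j
    induction i using Fin.lastCases <;> simp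
  · simp
  · congr 1
    ext i j
    simp

variable {K : Type*} [Field K]

lemma detSnoc_ne_zero_iff (a : Fin N → Fin (N + 1) → K) (b : Fin (N + 1) → K) :
    detSnoc a b ≠ 0 ↔ LinearIndependent K (Fin.snoc a b : Fin (N + 1) → Fin (N + 1) → K) := by
  rw [detSnoc_apply, ← isUnit_iff_ne_zero, ← Matrix.isUnit_iff_isUnit_det,
    ← Matrix.linearIndependent_rows_iff_isUnit]
  rfl

lemma detSnoc_eq_zero_iff {a : Fin N → Fin (N + 1) → K} (ha : LinearIndependent K a)
    {b : Fin (N + 1) → K} : detSnoc a b = 0 ↔ b ∈ Submodule.span K (Set.range a) := by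
  rw [← not_iff_not, ← ne_eq, detSnoc_ne_zero_iff, linearIndependent_finSnoc, and_iff_right ha]

lemma exists_detSnoc_ne_zero {a : Fin N → Fin (N + 1) → K} (ha : LinearIndependent K a) :
    ∃ b, detSnoc a b ≠ 0 := by
  simp_rw [detSnoc_ne_zero_iff]
  exact exists_linearIndependent_snoc_of_lt_finrank ha (by simp)

end DetSnoc

section DetForms

lemma exists_eq_mul_of_forall_eq_zero {K E : Type*} [Field K]
    [AddCommGroup E] [Module K E] (V : Submodule K E) {l l' : E →ₗ[K] K}
    (h : ∀ g ∈ V, l' g = 0 → l g = 0) : ∃ μ : K, ∀ g ∈ V, l g = μ * l' g := by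
  have hker : ⨅ _ : Unit, (l' ∘ₗ V.subtype).ker ≤ (l ∘ₗ V.subtype).ker := by
    rw [iInf_const]
    exact fun g hg => h g g.2 hg
  have hmem := mem_span_of_iInf_ker_le_ker hker
  rw [Set.range_const, Submodule.mem_span_singleton] at hmem
  obtain ⟨μ, hμ⟩ := hmem
  exact ⟨μ, fun g hg => (DFunLike.congr_fun hμ ⟨g, hg⟩).symm⟩

/-- The determinant of `N` forms of degree `N` and a further form of degree `N` as a linear
functional of the latter, in the coordinates `topPartials N`. -/
def detForms {R : Type*} [CommRing R] {N : ℕ} (f : Fin N → MvPolynomial (Fin 2) R) :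
    MvPolynomial (Fin 2) R →ₗ[R] R :=
  detSnoc (fun i => topPartials N (f i)) ∘ₗ topPartials N

lemma detForms_linearForm_pow {R : Type*} [CommRing R] {N : ℕ}
    (f : Fin N → MvPolynomial (Fin 2) R) (v : Fin 2 → R) :
    detForms f (linearForm v ^ N) = N.factorial * (-1) ^ N * (Matrix.of fun i k : Fin N =>
      topPartials N (f i) k.castSucc * v 0 + topPartials N (f i) k.succ * v 1).det := by
  rw [detForms, LinearMap.comp_apply, topPartials_linearForm_pow, map_smul,
    detSnoc_pow_mul_neg_pow, smul_eq_mul, mul_assoc]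

lemma span_range_le_homogeneousSubmodule {ι σ R : Type*} [CommRing R]
    {f : ι → MvPolynomial σ R} {N : ℕ} (hf : ∀ i, (f i).IsHomogeneous N) :
    Submodule.span R (Set.range f) ≤ homogeneousSubmodule σ R N :=
  Submodule.span_le.2 (Set.range_subset_iff.2 hf)

variable {K : Type*} [Field K] [CharZero K] {N : ℕ} {f : Fin N → MvPolynomial (Fin 2) K}

lemma linearIndependent_topPartials (hf : ∀ i, (f i).IsHomogeneous N)
    (hli : LinearIndependent K f) : LinearIndependent K fun i => topPartials N (f i) :=
  hli.map_injOn (topPartials N)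
    ((injOn_topPartials N).mono (span_range_le_homogeneousSubmodule hf))

lemma detForms_eq_zero_iff (hf : ∀ i, (f i).IsHomogeneous N) (hli : LinearIndependent K f)
    {g : MvPolynomial (Fin 2) K} (hg : g.IsHomogeneous N) :
    detForms f g = 0 ↔ g ∈ Submodule.span K (Set.range f) := by
  rw [detForms, LinearMap.comp_apply, detSnoc_eq_zero_iff (linearIndependent_topPartials hf hli),
    Set.range_comp' (topPartials N) f, ← Submodule.map_span, ← SetLike.mem_coe, Submodule.map_coe,
    (injOn_topPartials N).mem_image_iff (span_range_le_homogeneousSubmodule hf) hg,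
    SetLike.mem_coe]

lemma exists_detForms_ne_zero (hf : ∀ i, (f i).IsHomogeneous N) (hli : LinearIndependent K f) :
    ∃ g : MvPolynomial (Fin 2) K, g.IsHomogeneous N ∧ detForms f g ≠ 0 := by
  obtain ⟨b, hb⟩ := exists_detSnoc_ne_zero (linearIndependent_topPartials hf hli)
  obtain ⟨g, hg, rfl⟩ := exists_isHomogeneous_topPartials_eq b
  exact ⟨g, hg, hb⟩

end DetForms

section SubstForm

lemma substForm_linearForm (A : GL (Fin 2) ℂ) (v : Fin 2 → ℂ) :
    substForm A (linearForm (A • v)) = C A.val.det * linearForm v := by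
  refine MvPolynomial.funext fun w => ?_
  rw [eval_substForm]
  simp only [linearForm, map_mul, map_sub, eval_C, eval_X, Matrix.det_fin_two, Units.smul_def,
    Matrix.smul_eq_mulVec, Matrix.mulVec, dotProduct, Fin.sum_univ_two]
  ring

lemma substForm_linearForm_pow (A : GL (Fin 2) ℂ) (v : Fin 2 → ℂ) (N : ℕ) :
    substForm A (linearForm (A • v) ^ N) = A.val.det ^ N • linearForm v ^ N := by
  rw [← substEquiv_apply, map_pow, substEquiv_apply, substForm_linearForm, mul_pow, ← C_pow,
    smul_eq_C_mul]

lemma forall_substForm_mem_span_iff_detForms {N : ℕ} {f g : Fin N → BinPoly}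
    (hf : ∀ i, (f i).IsHomogeneous N) (hg : ∀ i, (g i).IsHomogeneous N)
    (hf_li : LinearIndependent ℂ f) (hg_li : LinearIndependent ℂ g) (A : GL (Fin 2) ℂ) :
    (∀ i, substForm A (g i) ∈ Submodule.span ℂ (Set.range f)) ↔
      ∃ μ : ℂ, μ ≠ 0 ∧ ∀ h : BinPoly, h.IsHomogeneous N →
        detForms f (substForm A h) = μ * detForms g h := by
  constructor
  · intro hspan
    have hle : Submodule.span ℂ (Set.range g) ≤
        (Submodule.span ℂ (Set.range f)).comap (substEquiv A).toLinearMap :=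
      Submodule.span_le.2 (Set.range_subset_iff.2 hspan)
    obtain ⟨μ, hμ⟩ := exists_eq_mul_of_forall_eq_zero (homogeneousSubmodule (Fin 2) ℂ N)
      (l := detForms f ∘ₗ (substEquiv A).toLinearMap) (l' := detForms g) fun h hh h0 =>
        (detForms_eq_zero_iff hf hf_li (isHomogeneous_substForm A hh)).2
          (hle ((detForms_eq_zero_iff hg hg_li hh).1 h0))
    refine ⟨μ, ?_, hμ⟩
    rintro rfl
    obtain ⟨h, hh, h0⟩ := exists_detForms_ne_zero hf hf_li
    have h1 := hμ _ (isHomogeneous_substForm A⁻¹ hh)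
    rw [zero_mul] at h1
    exact h0 (substForm_substForm_inv A h ▸ h1)
  · rintro ⟨μ, -, hμ⟩ i
    have hgi : detForms g (g i) = 0 :=
      (detForms_eq_zero_iff hg hg_li (hg i)).2 (Submodule.subset_span ⟨i, rfl⟩)
    rw [← detForms_eq_zero_iff hf hf_li (isHomogeneous_substForm A (hg i)), hμ _ (hg i), hgi,
      mul_zero]

end SubstForm

namespace ProjLineMorphism

variable {n : ℕ}

lemma detForms_coord_linearForm_pow (p : ProjLineMorphism n (n + 1)) (v : Fin 2 → ℂ) :
    detForms p.coord (linearForm v ^ (n + 1)) =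
      (n + 1).factorial * (-1) ^ (n + 1) * eval v p.osculating := by
  rw [detForms_linearForm_pow, osculating, RingHom.map_det]
  congr 2
  ext i k
  simp [iterate_pderiv_eq_topPartials (p.isHomogeneous i)]

lemma forall_detForms_substForm_eq_iff (p q : ProjLineMorphism n (n + 1)) (A : GL (Fin 2) ℂ)
    (μ : ℂ) :
    (∀ h : BinPoly, h.IsHomogeneous (n + 1) →
      detForms p.coord (substForm A h) = μ * detForms q.coord h) ↔
      C (A.val.det ^ (n + 1)) * p.osculating = C μ * substForm A q.osculating := by
  have hk : ((n + 1).factorial * (-1) ^ (n + 1) : ℂ) ≠ 0 :=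
    mul_ne_zero (Nat.cast_ne_zero.2 (Nat.factorial_ne_zero _)) (pow_ne_zero _ (by norm_num))
  have hpow := forall_isHomogeneous_eq_iff (N := n + 1)
    (l := detForms p.coord ∘ₗ (substEquiv A).toLinearMap) (l' := μ • detForms q.coord)
  refine hpow.trans ((MulAction.surjective A).forall.trans ?_)
  rw [MvPolynomial.funext_iff]
  refine forall_congr' fun v => ?_
  change detForms p.coord (substForm A _) = μ * detForms q.coord _ ↔ _
  rw [substForm_linearForm_pow, map_smul, detForms_coord_linearForm_pow,
    detForms_coord_linearForm_pow, smul_eq_mul, mul_left_comm, mul_left_comm μ,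
    mul_right_inj' hk]
  simp only [map_mul, eval_C, eval_substForm]

theorem forall_substForm_mem_span_iff (p q : ProjLineMorphism n (n + 1))
    (hp : LinearIndependent ℂ p.coord) (hq : LinearIndependent ℂ q.coord) (A : GL (Fin 2) ℂ) :
    (∀ i, substForm A (q.coord i) ∈ Submodule.span ℂ (Set.range p.coord)) ↔
      ∃ μ : ℂ, μ ≠ 0 ∧ substForm A q.osculating = C μ * p.osculating := by
  have hA : A.val.det ^ (n + 1) ≠ 0 :=
    pow_ne_zero _ ((Matrix.isUnit_iff_isUnit_det _).1 A.isUnit).ne_zero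
  simp_rw [forall_substForm_mem_span_iff_detForms p.isHomogeneous q.isHomogeneous hp hq,
    forall_detForms_substForm_eq_iff]
  constructor
  · rintro ⟨μ, hμ, h⟩
    refine ⟨_, div_ne_zero hA hμ, ?_⟩
    rw [div_eq_inv_mul, C_mul, mul_assoc, h, ← mul_assoc, ← C_mul, inv_mul_cancel₀ hμ, C_1,
      one_mul]
  · rintro ⟨μ, hμ, h⟩
    refine ⟨_, div_ne_zero hA hμ, ?_⟩
    rw [h, ← mul_assoc, ← C_mul, div_mul_cancel₀ _ hμ]

end ProjLineMorphism

lemma exists_GL_forall_eq_sum {K V ι : Type*} [Field K] [AddCommGroup V] [Module K V] [Fintype ι]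
    [DecidableEq ι] {f g : ι → V} (hg : LinearIndependent K g)
    (h : ∀ i, g i ∈ Submodule.span K (Set.range f)) :
    ∃ M : GL ι K, ∀ i, g i = ∑ j, M i j • f j := by
  simp_rw [Submodule.mem_span_range_iff_exists_fun] at h
  choose M hM using h
  have hdet : (Matrix.of M).det ≠ 0 := by
    intro h0
    obtain ⟨w, hw, hwM⟩ := Matrix.exists_vecMul_eq_zero_iff.2 h0
    refine hw (funext (Fintype.linearIndependent_iff.1 hg w ?_))
    simp_rw [← hM, Finset.smul_sum, smul_smul]
    rw [Finset.sum_comm]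
    simp_rw [← Finset.sum_smul]
    exact Finset.sum_eq_zero fun j _ => by
      rw [show ∑ i, w i * M i j = 0 from congrFun hwM j, zero_smul]
  exact ⟨Matrix.GeneralLinearGroup.mkOfDetNeZero _ hdet, fun i => (hM i).symm⟩

namespace ProjLineMorphism

variable {n d : ℕ}

/-- The relation `φ ∘ p = q ∘ ψ`: the reparameterization `ψ` of `ℙ¹` is a lift of the projective
transformation `φ` along `p` and `q`. It is the graph of `ι`. -/
def IsLift (p q : ProjLineMorphism n d) (φ : ProjAut n) (ψ : ProjAut 1) : Prop :=
  ∀ x, φ • p.toMap x = q.toMap (ψ • x)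

variable {p q : ProjLineMorphism n d} {φ φ' : ProjAut n} {ψ ψ' : ProjAut 1}

lemma IsLift.left_unique (hp : LinearIndependent ℂ p.coord) (h : p.IsLift q φ ψ)
    (h' : p.IsLift q φ' ψ) : φ = φ' :=
  projAut_eq_of_eventually_smul_toMap_eq hp
    (Filter.Eventually.of_forall fun x => (h x).trans (h' x).symm)

lemma IsLift.right_unique (hq : GenericallyInjective q.toMap) (h : p.IsLift q φ ψ)
    (h' : p.IsLift q φ ψ') : ψ = ψ' := by
  have hev := hq.eventually_eq_of_comp_eq (MulAction.injective ψ) (MulAction.injective ψ')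
    fun x => (h x).symm.trans (h' x)
  refine projAut_eq_of_eventually_smul_toMap_eq (p := idLine) (linearIndependent_X (Fin 2) ℂ) ?_
  simpa only [toMap_idLine] using hev

lemma IsLift.image_smul_range (h : p.IsLift q φ ψ) :
    (fun x => φ • x) '' Set.range p.toMap = Set.range q.toMap := by
  rw [← Set.range_comp, ← (MulAction.surjective ψ).range_comp q.toMap]
  exact congrArg Set.range (funext h)

theorem exists_isLift_iff_image_smul_range (hd : d ≠ 0) (hp : GenericallyInjective p.toMap)
    (hq : GenericallyInjective q.toMap) :
    (∃ ψ, p.IsLift q φ ψ) ↔ (fun x => φ • x) '' Set.range p.toMap = Set.range q.toMap := by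
  refine ⟨fun ⟨_, h⟩ => h.image_smul_range, fun h => ?_⟩
  obtain ⟨M, rfl⟩ := Matrix.ProjGenLinGroup.mk_surjective φ
  have hcomp : (p.postcomp M).toMap = (fun x => Matrix.ProjGenLinGroup.mk M • x) ∘ p.toMap :=
    funext (toMap_postcomp p M)
  have hr : GenericallyInjective (p.postcomp M).toMap := by
    obtain ⟨S, hS, hinj⟩ := hp
    exact ⟨S, hS, hcomp ▸ (MulAction.injective _).comp_injOn hinj⟩
  have hrange : Set.range (p.postcomp M).toMap ⊆ Set.range q.toMap := by
    rw [hcomp, Set.range_comp, h]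
  obtain ⟨A, c, hc, hA⟩ := exists_coord_eq_C_mul_substForm hd hr hq hrange
  exact ⟨_, (smul_toMap_eq_toMap_smul_iff p q M A).2 ⟨c, hc, hA⟩⟩

lemma exists_isLift_mk_iff (hq : LinearIndependent ℂ q.coord) (A : GL (Fin 2) ℂ) :
    (∃ φ, p.IsLift q φ (Matrix.ProjGenLinGroup.mk A)) ↔
      ∀ i, substForm A (q.coord i) ∈ Submodule.span ℂ (Set.range p.coord) := by
  constructor
  · rintro ⟨φ, h⟩ i
    obtain ⟨M, rfl⟩ := Matrix.ProjGenLinGroup.mk_surjective φ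
    obtain ⟨c, hc, hM⟩ := (smul_toMap_eq_toMap_smul_iff p q M A).1 h
    rw [← Submodule.smul_mem_iff _ hc, smul_eq_C_mul, ← hM]
    exact Submodule.sum_mem _ fun j _ =>
      smul_eq_C_mul (p.coord j) _ ▸ Submodule.smul_mem _ _ (Submodule.subset_span ⟨j, rfl⟩)
  · intro h
    obtain ⟨M, hM⟩ := exists_GL_forall_eq_sum (hq.map' (substEquiv A).toLinearMap
      (LinearMap.ker_eq_bot.2 (substEquiv A).injective)) h
    refine ⟨Matrix.ProjGenLinGroup.mk M, (smul_toMap_eq_toMap_smul_iff p q M A).2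
      ⟨1, one_ne_zero, fun i => ?_⟩⟩
    simp_rw [C_1, one_mul, ← smul_eq_C_mul]
    exact (hM i).symm

theorem exists_isLift_iff_mem_formEquivs {p q : ProjLineMorphism n (n + 1)}
    (hp : LinearIndependent ℂ p.coord) (hq : LinearIndependent ℂ q.coord) :
    (∃ φ, p.IsLift q φ ψ) ↔ ψ ∈ formEquivs p.osculating q.osculating := by
  constructor
  · intro h
    obtain ⟨A, rfl⟩ := Matrix.ProjGenLinGroup.mk_surjective ψ
    exact ⟨A, rfl, (forall_substForm_mem_span_iff p q hp hq A).1 ((exists_isLift_mk_iff hq A).1 h)⟩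
  · rintro ⟨A, rfl, hA⟩
    exact (exists_isLift_mk_iff hq A).2 ((forall_substForm_mem_span_iff p q hp hq A).2 hA)

end ProjLineMorphism

end OsculatingCurves

end

open OsculatingCurves ProjLineMorphism in
theorem mainTheorem2 (n : ℕ) (p q : OsculatingCurves.RationalCurve n (n + 1)) :
    (∃ ι : OsculatingCurves.projEquivs p.points q.points →
        OsculatingCurves.formEquivs p.osculating q.osculating,
      (∀ (φ : OsculatingCurves.projEquivs p.points q.points) (ψ : OsculatingCurves.ProjAut 1),
        (∀ x : OsculatingCurves.ProjSpace 1,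
          (φ : OsculatingCurves.ProjAut n) • p.toMap x = q.toMap (ψ • x)) ↔
        ψ = (ι φ : OsculatingCurves.ProjAut 1)) ∧
      Function.Bijective ι) ∧
    ((OsculatingCurves.projEquivs p.points q.points).Nonempty ↔
      (OsculatingCurves.formEquivs p.osculating q.osculating).Nonempty) := by
  choose ψ hψ using fun φ : projEquivs p.points q.points =>
    (exists_isLift_iff_image_smul_range n.succ_ne_zero p.birational q.birational).2 φ.2
  have hform {ψ : ProjAut 1} := exists_isLift_iff_mem_formEquivs (ψ := ψ) p.nondegenerate
    q.nondegenerate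
  let ι (φ : projEquivs p.points q.points) : formEquivs p.osculating q.osculating :=
    ⟨ψ φ, hform.1 ⟨φ, hψ φ⟩⟩
  have hinj : Function.Injective ι := fun φ φ' h => by
    have hψ_eq : ψ φ = ψ φ' := congrArg Subtype.val h
    exact Subtype.ext ((hψ φ).left_unique p.nondegenerate (hψ_eq ▸ hψ φ'))
  have hsurj : Function.Surjective ι := fun ⟨ψ', h⟩ => by
    obtain ⟨φ, hφ⟩ := hform.2 h
    exact ⟨⟨φ, hφ.image_smul_range⟩, Subtype.ext ((hψ _).right_unique q.birational hφ)⟩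
  refine ⟨⟨ι, fun φ ψ' => ⟨fun h => IsLift.right_unique q.birational h (hψ φ), ?_⟩,
    hinj, hsurj⟩, ?_⟩
  · rintro rfl
    exact hψ φ
  · rw [← Set.nonempty_coe_sort, ← Set.nonempty_coe_sort]
    exact (Equiv.ofBijective ι ⟨hinj, hsurj⟩).nonempty_congr
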